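/- Let $\mathbb{F}^n$ be the $n$-dimensional vector space over $GF(2)$ with the Hamming distance $d$. For $v\in\mathbb{F}^n$ and a coordinate permutation $\pi\in S_n$, let $(v,\pi)$ denote the isometry $x\mapsto v+\pi(x)$ of $\mathbb{F}^n$. A code $C\subseteq\mathbb{F}^n$ is called perfect if for every $x\in\mathbb{F}^n$ there is exactly one $y\in C$ with $d(x,y)\le 1$. It is called propelinear if one can assign to each codeword $x\in C$ a permutation $\pi_x\in S_n$ such that $(x,\pi_x)$ maps $C$ onto $C$ for every $x\in C$, and $\pi_{(x,\pi_x)(y)}=\pi_x\pi_y$ for all $x,y\in C$. The rank of $C$ is the dimension of its linear span. Theorem. Let $n=2^m-1$ with $m\ge 4$, and let $r$ be an integer with $n-\log_2(n+1)\le r\le n$. Suppose that it is not the case that $n=r=63$, or that $n=127$ and $r\in\{126,127\}$, or that $n=r=2047$. Then there exists a propelinear perfect binary code $C\subseteq\mathbb{F}^n$ of length $n$ and rank $r$ containing the all-zero vector. -/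

import Mathlib

/-- The binary vector space of dimension `n` over GF(2); the Hamming distance on it is
Mathlib's `hammingDist`. A binary code of length `n` is a term of `Set (BinVec n)`. -/
abbrev BinVec (n : ℕ) : Type := Fin n → ZMod 2

/-- The action of a coordinate permutation on vectors: the entry of `x` at position `i` is moved
to position `π i`, so that `permAct (π * τ) x = permAct π (permAct τ x)`. -/
def permAct {n : ℕ} (π : Equiv.Perm (Fin n)) (x : BinVec n) : BinVec n :=
  fun i => x (π.symm i)

theorem permAct_mul {n : ℕ} (π τ : Equiv.Perm (Fin n)) (x : BinVec n) :
    permAct (π * τ) x = permAct π (permAct τ x) := rfl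

/-- The isometry `(v, π)` of the Hamming space, acting by `(v, π)(x) = v + π(x)`. -/
def isoMap {n : ℕ} (v : BinVec n) (π : Equiv.Perm (Fin n)) (x : BinVec n) : BinVec n :=
  v + permAct π x

/-- The isometry `(v, π)` belongs to the automorphism group Iso(C): it fixes `C` set-wise. -/
def IsCodeAut {n : ℕ} (C : Set (BinVec n)) (v : BinVec n) (π : Equiv.Perm (Fin n)) : Prop :=
  isoMap v π '' C = C

/-- A single-error-correcting perfect binary code. -/
def IsPerfectCode {n : ℕ} (C : Set (BinVec n)) : Prop :=
  ∀ x : BinVec n, ∃! y : BinVec n, y ∈ C ∧ hammingDist x y ≤ 1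

/-- A propelinear structure on `C`: an assignment `x ↦ π_x` of coordinate permutations to the
codewords such that `(x, π_x)` is an automorphism of `C` for every codeword `x`, and
`π_z = π_x π_y` whenever `x, y` are codewords and `z = (x, π_x)(y)` (which is a codeword). -/
structure PropelinearStructure {n : ℕ} (C : Set (BinVec n)) where
  perm : C → Equiv.Perm (Fin n)
  isCodeAut : ∀ x : C, IsCodeAut C x (perm x)
  perm_star : ∀ x y z : C, (z : BinVec n) = isoMap x (perm x) y → perm z = perm x * perm y

/-- A code is propelinear if it has a propelinear structure. -/
def IsPropelinear {n : ℕ} (C : Set (BinVec n)) : Prop :=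
  Nonempty (PropelinearStructure C)

/-- The rank of a code: the dimension over GF(2) of its linear span. -/
noncomputable def codeRank {n : ℕ} (C : Set (BinVec n)) : ℕ :=
  Module.finrank (ZMod 2) (Submodule.span (ZMod 2) C)

/-! Induction on `m`, tracking the deficiency `d = n - rank`, which has to take every value from `0`
to `m`. For length 15, five explicit unions of cosets of linear codes are certified by finite
computation.

The step from `n` to `2n + 1` is Vasil'ev's construction: take the vectors whose sum of halves `y`
lies in `C` and whose parity equals `f y`. For `f = 0` the rank grows by `n`, so the deficiency
grows by one (`rank_vasilev_zero`). This yields every deficiency except `0`. For `C` of full rank,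
the new code has full rank as soon as `f` agrees with no linear form on `C` (`span_vasilev_eq_top`).
It is propelinear if `f` is a homomorphism up to linear terms whose coefficients form a crossed
homomorphism: lifting a permutation with some pairs swapped changes the parity by exactly such a
linear term.

Such an `f` exists because `C`, under its propelinear operation, is a 2-group: `|C| (n + 1) = 2 ^
n`. It acts by translation on the functions `C → GF(2)` modulo affine ones, a finite space that is
nonzero since `|C| > n + 1`. A 2-group acting there fixes a nonzero vector, that is, a non-affine
function all of whose derivatives are affine (`CodeGroup.exists_nonaffine`). As `C` spans the space,
the linear parts of the derivatives are unique, and associativity makes them a crossed homomorphism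
(`corr_star_of_span_eq_top`). -/

/-- The difference between a vector and its neighbour: zero, or a vector of weight one. -/
def unitOrZero {ι : Type} [DecidableEq ι] (o : Option ι) : ι → ZMod 2 :=
  o.elim 0 fun i => Pi.single i 1

/-- A perfect code containing `0`, on an arbitrary index type, with a propelinear structure. -/
structure PropelinearPerfectCode (ι : Type) [Fintype ι] [DecidableEq ι] where
  carrier : Set (ι → ZMod 2)
  perm : (ι → ZMod 2) → Equiv.Perm ι
  zero_mem : 0 ∈ carrier
  perfect : ∀ x, ∃! o : Option ι, x + unitOrZero o ∈ carrier
  star_mem : ∀ x ∈ carrier, ∀ y ∈ carrier, x + y ∘ (perm x).symm ∈ carrier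
  perm_star : ∀ x ∈ carrier, ∀ y ∈ carrier, perm (x + y ∘ (perm x).symm) = perm x * perm y

/-- The dimension of the linear span of the code. -/
noncomputable def PropelinearPerfectCode.rank {ι : Type} [Fintype ι] [DecidableEq ι]
    (C : PropelinearPerfectCode ι) : ℕ :=
  Module.finrank (ZMod 2) (Submodule.span (ZMod 2) C.carrier)

/-! ### Linear algebra over GF(2) on natural numbers -/

/-- The binary expansion of a natural number, as a sequence of elements of `GF(2)`. -/
def bitSeq (z : ℕ) : ℕ → ZMod 2 := fun j => if z.testBit j then 1 else 0

theorem bitSeq_xor (a b : ℕ) : bitSeq (a ^^^ b) = bitSeq a + bitSeq b := by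
  funext j
  simp only [bitSeq, Pi.add_apply, Nat.testBit_xor]
  cases a.testBit j <;> cases b.testBit j <;> decide

theorem bitSeq_injective : Function.Injective bitSeq := by
  intro a b h
  refine Nat.eq_of_testBit_eq fun j => ?_
  have := congrFun h j
  simp only [bitSeq] at this
  revert this
  cases a.testBit j <;> cases b.testBit j <;> decide

@[simp] theorem bitSeq_zero : bitSeq 0 = 0 := by funext j; simp [bitSeq]

theorem bitSeq_two_pow (k : ℕ) : bitSeq (2 ^ k) = Pi.single k 1 := by
  funext j
  by_cases h : k = j
  · subst h; simp [bitSeq]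
  · simp [bitSeq, h, Ne.symm h]

theorem bitSeq_eq_zero_of_lt {z e j : ℕ} (hz : z < 2 ^ e) (hj : e ≤ j) : bitSeq z j = 0 := by
  have : z.testBit j = false :=
    Nat.testBit_lt_two_pow (hz.trans_le (Nat.pow_le_pow_right (by norm_num) hj))
  simp [bitSeq, this]

/-- The sum modulo two of those entries of the list that are selected by the bits of `z`. -/
def xorCols : List ℕ → ℕ → ℕ
  | [], _ => 0
  | c :: cs, z => Nat.xor (Nat.mul (Nat.mod z 2) c) (xorCols cs (Nat.div z 2))

/-- The linear map given by the list of its columns. -/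
def colMap : List ℕ → (ℕ → ZMod 2) →ₗ[ZMod 2] (ℕ → ZMod 2)
  | [] => 0
  | c :: cs => (LinearMap.proj 0 : (ℕ → ZMod 2) →ₗ[ZMod 2] ZMod 2).smulRight (bitSeq c) +
      (colMap cs).comp (LinearMap.funLeft (ZMod 2) (ZMod 2) Nat.succ)

theorem colMap_bitSeq (cs : List ℕ) (z : ℕ) : colMap cs (bitSeq z) = bitSeq (xorCols cs z) := by
  induction cs generalizing z with
  | nil => simp [colMap, xorCols]
  | cons c cs ih =>
    have h1 : LinearMap.funLeft (ZMod 2) (ZMod 2) Nat.succ (bitSeq z) = bitSeq (z / 2) := by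
      funext j
      simp [bitSeq, LinearMap.funLeft_apply, Nat.testBit_succ]
    have h2 : bitSeq z 0 • bitSeq c = bitSeq (z % 2 * c) := by
      rcases Nat.mod_two_eq_zero_or_one z with h | h <;> simp [bitSeq, Nat.testBit_zero, h]
    have h3 : xorCols (c :: cs) z = (z % 2 * c) ^^^ xorCols cs (z / 2) := rfl
    simp only [colMap, LinearMap.add_apply, LinearMap.comp_apply, h1, ih,
      LinearMap.smulRight_apply, LinearMap.proj_apply, h2, h3, bitSeq_xor]

/-- Links the recursive form, which can be evaluated, with the sum that defines `syndromeMap`. -/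
theorem colMap_eq_sum (cs : List ℕ) {n : ℕ} (hn : cs.length = n) (v : ℕ → ZMod 2) :
    colMap cs v = ∑ i : Fin n, v i • bitSeq (cs.getD i 0) := by
  subst hn
  induction cs generalizing v with
  | nil => simp [colMap]
  | cons c cs ih =>
    simp only [colMap, LinearMap.add_apply, LinearMap.comp_apply, ih,
      LinearMap.smulRight_apply, LinearMap.proj_apply, List.length_cons, Fin.sum_univ_succ]
    simp [LinearMap.funLeft_apply]

/-! ### Computable certificates for length 15 -/

/-- A code of length 15 that is a union of cosets of a linear code `K`: the syndromes modulo `K` of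
the unit vectors, vectors whose syndromes are the unit vectors, the syndromes of the codewords
together with their permutations (written in base 16), and the set of these syndromes as a bit
mask. -/
structure SyndromeTable where
  cols : List ℕ
  lifts : List ℕ
  words : List (ℕ × ℕ)
  mask : ℕ

/-- The value at `i` of the map with table `P`. -/
def nibble (P i : ℕ) : ℕ := Nat.mod (Nat.div P (Nat.pow 16 i)) 16

/-- The permutation belonging to a syndrome, and `0` if there is none. -/
def lookupWord : List (ℕ × ℕ) → ℕ → ℕ
  | [], _ => 0
  | w :: ws, z => bif Nat.beq w.1 z then w.2 else lookupWord ws z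

namespace SyndromeTable

variable (T : SyndromeTable)

/-- The action on syndromes of the permutation with table `P`. -/
def action (P : ℕ) : List ℕ :=
  T.lifts.map (xorCols ((List.range 15).map fun i => T.cols.getD (nibble P i) 0))

/-- Membership of a syndrome in the code, read off from the mask. -/
def has (z : ℕ) : Bool := Nat.beq (Nat.mod (Nat.div T.mask (Nat.pow 2 z)) 2) 1

/-- The table `P` describes a permutation which acts on the syndromes as it should. -/
def permCheck (P : ℕ) : Bool :=
  (List.range 15).all fun i => Nat.blt (nibble P i) 15 &&
    ((List.range 15).any fun j => Nat.beq (nibble P j) i) &&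
    Nat.beq (xorCols (T.action P) (T.cols.getD i 0)) (T.cols.getD (nibble P i) 0)

/-- The code is closed under the operation, with the right permutations, for the left factor `w`. -/
def starCheck (w : ℕ × ℕ) (A : List ℕ) : Bool :=
  T.words.all fun t =>
    (fun R => (List.range 15).all (fun i => Nat.beq (nibble R i) (nibble w.2 (nibble t.2 i))) &&
      Nat.blt 0 R) (lookupWord T.words (Nat.xor w.1 (xorCols A t.1)))

/-- Exactly one of the neighbours of a vector with syndrome `z` is a codeword. -/
def perfectCheck (z : ℕ) : Bool :=
  (List.range 16).any fun o => (List.range 16).all fun k =>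
    (T.has (Nat.xor z ((0 :: T.cols).getD k 0))) == Nat.beq k o

/-- The table describes a propelinear perfect code whose syndromes span the first `e` unit
vectors. -/
def check (e : ℕ) : Bool :=
  Nat.beq T.cols.length 15 &&
  T.cols.all (fun c => Nat.blt c (Nat.pow 2 T.lifts.length)) &&
  (List.range T.lifts.length).all
    (fun j => Nat.beq (xorCols T.cols (T.lifts.getD j 0)) (Nat.pow 2 j)) &&
  T.has 0 &&
  (List.range e).all (fun j => T.has (Nat.pow 2 j)) &&
  T.words.all (fun w => Nat.blt w.1 (Nat.pow 2 e)) &&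
  (List.range (Nat.pow 2 T.lifts.length)).all
    (fun z => T.has z == Nat.blt 0 (lookupWord T.words z)) &&
  (List.range (Nat.pow 2 T.lifts.length)).all T.perfectCheck &&
  T.words.all (fun w => T.permCheck w.2) &&
  T.words.all (fun w => T.starCheck w (T.action w.2))

end SyndromeTable

/-! ### The five certificates -/

/-- A propelinear perfect code of length 15 and rank 11. -/
def table11 : SyndromeTable where
  cols := [1, 2, 3, 4, 5, 6, 7, 8, 9, 10, 11, 12, 13, 14, 15]
  lifts := [1, 2, 8, 128]
  words := [(0, 0xedcba9876543210)]
  mask :=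
    0x1

/-- The argument of `check` is the dimension spanned by the syndromes of codewords; the deficiency
is `lifts.length` minus it. Here only syndrome `0` occurs, so this is the Hamming code with identity
permutations. -/
theorem table11_check : table11.check 0 = true := by decide +kernel

/-- A propelinear perfect code of length 15 and rank 12. -/
def table12 : SyndromeTable where
  cols := [16, 32, 64, 126, 47, 31, 79, 113, 82, 58, 14, 104, 92, 52, 102]
  lifts := [29, 261, 524, 774, 1, 2, 4]
  words := [(0, 0xedcba9876543210), (1, 0xedcba9832017645), (2, 0xedcba9845671032), (3,
    0xedcba9810234576), (4, 0xedcba9867452301), (5, 0xedcba9823106754), (8, 0xedcba9854760123),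
    (9, 0xedcba9801325467)]
  mask :=
    0x33f

theorem table12_check : table12.check 4 = true := by decide +kernel

/-- A propelinear perfect code of length 15 and rank 13. -/
def table13 : SyndromeTable where
  cols := [32, 64, 77, 54, 90, 47, 87, 57, 100, 127, 14, 27, 106, 113, 21]
  lifts := [29, 39, 259, 280, 301, 1, 2]
  words := [(0, 0xedcba9876543210), (1, 0xedcba9832017645), (2, 0xedcba9801325467), (3,
    0xedcba9854760123), (4, 0xedcba9867452301), (8, 0xedcba9810234576), (16, 0xedcba9823106754),
    (28, 0xedcba9845671032)]
  mask :=
    0x1001011f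

theorem table13_check : table13.check 5 = true := by decide +kernel

/-- A propelinear perfect code of length 15 and rank 14. -/
def table14 : SyndromeTable where
  cols := [256, 298, 503, 494, 476, 453, 283, 305, 46, 213, 89, 162, 51, 251, 200]
  lifts := [23, 77, 259, 518, 541, 584, 1036, 1285, 1]
  words := [(0, 0xedcba9876543210), (1, 0xedcba9810234576), (2, 0xedcba9801325467), (3,
    0xedcba9867452301), (4, 0xedcab9867452301), (5, 0xedcab9801325467), (6, 0xedcab9810234576),
    (7, 0xedcab9876543210), (8, 0xedcab9854760123), (15, 0xedcba9854760123), (16,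
    0xedcab9832017645), (23, 0xedcba9832017645), (32, 0xedcab9823106754), (39, 0xedcba9823106754),
    (56, 0xedcab9845671032), (63, 0xedcba9845671032), (64, 0xedcba8967452301), (65,
    0xedcba8901325467), (66, 0xedcba8910234576), (67, 0xedcba8976543210), (76, 0xedcba8954760123),
    (84, 0xedcba8932017645), (100, 0xedcba8923106754), (124, 0xedcba8945671032), (128,
    0xedcab8945671032), (152, 0xedcab8923106754), (168, 0xedcab8932017645), (176,
    0xedcab8954760123), (188, 0xedcab8967452301), (189, 0xedcab8901325467), (190,
    0xedcab8910234576), (191, 0xedcab8976543210)]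
  mask :=
    0xf001010001000001100000100010100f81000081008181ff

theorem table14_check : table14.check 8 = true := by decide +kernel

/-- A propelinear perfect code of length 15 and rank 15. -/
def table15 : SyndromeTable where
  cols := [120, 510, 99, 29, 7, 408, 496, 26, 445, 406, 228, 340, 923, 606, 467]
  lifts := [29, 54, 59, 79, 97, 262, 297, 1044, 1050, 4107]
  words := [(0, 0xedcba9876543210), (1, 0xa91e2867cd43b05), (2, 0x256ba814dc73e09), (4,
    0xb56e2c148073ad9), (8, 0xb802e1c75643a9d), (9, 0x219abd578043ec6), (16, 0xacd2e6849173b50),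
    (22, 0xe80ab6d4917325c), (32, 0xecdab9845673210), (48, 0xbdc2e5879143a60), (54,
    0xe80ba5c7914326d), (60, 0xb91e2854dc73a06), (64, 0xa802e1d46573b9c), (81, 0xa65e2d178043bc9),
    (87, 0x265ab817cd43e09), (92, 0x219bac648073ed5), (128, 0xe91bad6780432c5), (137,
    0x2dcab1875643e90), (141, 0xa652ec948073bd1), (153, 0xbcde25841973a60), (161,
    0xb80e29d45673a1c), (182, 0xe56ba897cd43201), (215, 0x280ab6c71943e5d), (221,
    0xa192e864dc73b05), (256, 0xb562ed978043ac1), (269, 0xe91abc5480732d6), (303,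
    0x280ba5d41973e6c), (305, 0xa80e29c76543b1d), (312, 0xb192e857cd43a06), (315,
    0xe65ab894dc73201), (353, 0xadce26871943b50), (369, 0x2cdba1846573e90), (512,
    0xa082e9c45673b1d), (529, 0xa56e2c970843bd1), (545, 0x291abc670843ed5), (552,
    0xecdba1075643298), (554, 0x265ba094cd73e81), (574, 0xe08ab5c4197326d), (624,
    0xbcd2e6071943a58), (636, 0xb19e2064cd73a85), (648, 0xe19abd6408732c5), (669,
    0xa912e054cd73b86), (673, 0x2cdab9076543e18), (680, 0xe19bac5708432d6), (725,
    0xb912e067dc43a85), (732, 0xa08e21d75643b9c), (737, 0xb08e21c46573a9d), (756,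
    0x2dcba9045673e18), (775, 0x208ba6c49173e5d), (787, 0xe56ab014cd73289), (801,
    0xacde25079143b68), (819, 0xe65ba017dc43289), (832, 0xb652ec170843ad9), (850,
    0x208ab5d79143e6c), (864, 0xa562ed140873bc9), (884, 0xbdce26049173a58), (933,
    0xedcab1046573298), (947, 0xe08ba6d7194325c), (978, 0x256ab097dc43e81), (985,
    0x291bad540873ec6), (997, 0xb082e9d76543a1c), (1001, 0xb65e2d940873ac1), (1004,
    0xa19e2057dc43b86), (1021, 0xadc2e5041973b68)]
  mask :=
    0x2000122002040000000800200000000000100001000400010008000200080080001000021020000000000102200001001001000000000000400005020002000100000000000000000000000000000000000200020000000009028000000020010000000020800000004000020200220100000000108200011041000100410317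

theorem table15_check : table15.check 10 = true := by decide +kernel

/-! ### From a verified certificate to a code and its rank -/

namespace SyndromeTable

variable (T : SyndromeTable)

/-- The properties of a table that are verified by `check`. -/
structure Valid (T : SyndromeTable) (e : ℕ) : Prop where
  length_cols : T.cols.length = 15
  cols_lt : ∀ c ∈ T.cols, c < 2 ^ T.lifts.length
  lifts_spec : ∀ j < T.lifts.length, xorCols T.cols (T.lifts.getD j 0) = 2 ^ j
  has_zero : T.has 0 = true
  has_two_pow : ∀ j < e, T.has (2 ^ j) = true
  words_lt : ∀ w ∈ T.words, w.1 < 2 ^ e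
  has_iff : ∀ z < 2 ^ T.lifts.length, (T.has z = true ↔ lookupWord T.words z ≠ 0)
  perfect : ∀ z < 2 ^ T.lifts.length, ∃ o < 16, ∀ k < 16,
    (T.has (z ^^^ (0 :: T.cols).getD k 0) = true ↔ k = o)
  nibble_lt : ∀ w ∈ T.words, ∀ i < 15, nibble w.2 i < 15
  nibble_surj : ∀ w ∈ T.words, ∀ i < 15, ∃ j < 15, nibble w.2 j = i
  action_col : ∀ w ∈ T.words, ∀ i < 15,
    xorCols (T.action w.2) (T.cols.getD i 0) = T.cols.getD (nibble w.2 i) 0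
  star_ne : ∀ w ∈ T.words, ∀ t ∈ T.words,
    lookupWord T.words (w.1 ^^^ xorCols (T.action w.2) t.1) ≠ 0
  star_nibble : ∀ w ∈ T.words, ∀ t ∈ T.words, ∀ i < 15,
    nibble (lookupWord T.words (w.1 ^^^ xorCols (T.action w.2) t.1)) i =
      nibble w.2 (nibble t.2 i)

theorem valid_of_check {e : ℕ} (h : T.check e = true) : T.Valid e := by
  simp only [check, Bool.and_eq_true, Nat.beq_eq, Nat.blt_eq, List.all_eq_true, List.mem_range,
    beq_iff_eq, perfectCheck, List.any_eq_true, permCheck, starCheck] at h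
  obtain ⟨⟨⟨⟨⟨⟨⟨⟨⟨h1, h2⟩, h3⟩, h4⟩, h5⟩, h6⟩, h7⟩, h8⟩, h9⟩, h10⟩ := h
  refine ⟨h1, h2, h3, h4, h5, h6, ?_, ?_, fun w hw i hi => (h9 w hw i hi).1.1,
    fun w hw i hi => (h9 w hw i hi).1.2, fun w hw i hi => (h9 w hw i hi).2,
    fun w hw t ht => Nat.pos_iff_ne_zero.1 (h10 w hw t ht).2,
    fun w hw t ht => (h10 w hw t ht).1⟩
  · intro z hz
    rw [h7 z hz, Nat.blt_eq, Nat.pos_iff_ne_zero]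
  · intro z hz
    obtain ⟨o, ho, h⟩ := h8 z hz
    refine ⟨o, ho, fun k hk => ?_⟩
    have := h k hk
    change T.has (Nat.xor z ((0 :: T.cols).getD k 0)) = true ↔ k = o
    rw [this, Nat.beq_eq]

theorem mem_of_lookupWord_ne {ws : List (ℕ × ℕ)} {z : ℕ} (h : lookupWord ws z ≠ 0) :
    (z, lookupWord ws z) ∈ ws := by
  induction ws with
  | nil => simp [lookupWord] at h
  | cons w ws ih =>
    rcases hb : Nat.beq w.1 z with _ | _
    · simp only [lookupWord, hb, cond_false] at h ⊢
      exact List.mem_cons_of_mem _ (ih h)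
    · have : w.1 = z := Nat.eq_of_beq_eq_true hb
      simp only [lookupWord, hb, cond_true]
      rw [← this]
      exact List.mem_cons_self

/-- The map with table `P`, on coordinates. -/
def nibbleMap (P : ℕ) (i : Fin 15) : Fin 15 := Fin.ofNat 15 (nibble P i)

open Classical in
/-- The permutation with table `P`. -/
noncomputable def permOf (P : ℕ) : Equiv.Perm (Fin 15) :=
  if h : Function.Bijective (nibbleMap P) then Equiv.ofBijective _ h else 1

/-- The syndrome of a vector, as a sequence of bits. -/
noncomputable def syndromeMap : (Fin 15 → ZMod 2) →ₗ[ZMod 2] (ℕ → ZMod 2) :=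
  Fintype.linearCombination (ZMod 2) fun i : Fin 15 => bitSeq (T.cols.getD i 0)

theorem syndromeMap_single (i : Fin 15) :
    T.syndromeMap (Pi.single i 1) = bitSeq (T.cols.getD i 0) := by
  simp [syndromeMap, Fintype.linearCombination_apply_single]

variable {T} {e : ℕ}

namespace Valid

theorem getD_lt (hT : T.Valid e) (i : ℕ) : T.cols.getD i 0 < 2 ^ T.lifts.length := by
  rcases lt_or_ge i T.cols.length with h | h
  · rw [List.getD_eq_getElem _ _ h]
    exact hT.cols_lt _ (List.getElem_mem h)
  · rw [List.getD_eq_default _ _ h]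
    positivity

/-- Numbers below a power of two are closed under xor. Hence inverting `bitSeq` in `syndrome` never
meets a junk value. -/
theorem exists_syndrome (hT : T.Valid e) (x : Fin 15 → ZMod 2) :
    ∃ z < 2 ^ T.lifts.length, T.syndromeMap x = bitSeq z := by
  rw [syndromeMap, Fintype.linearCombination_apply]
  refine Finset.sum_induction _ (fun v => ∃ z < 2 ^ T.lifts.length, v = bitSeq z) ?_ ?_ ?_
  · rintro _ _ ⟨a, ha, rfl⟩ ⟨b, hb, rfl⟩
    exact ⟨a ^^^ b, Nat.xor_lt_two_pow ha hb, (bitSeq_xor a b).symm⟩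
  · exact ⟨0, by positivity, bitSeq_zero.symm⟩
  · intro i _
    have : ∀ a : ZMod 2, a = 0 ∨ a = 1 := by decide
    rcases this (x i) with h | h
    · exact ⟨0, by positivity, by rw [h, zero_smul, bitSeq_zero]⟩
    · exact ⟨_, hT.getD_lt i, by rw [h, one_smul]⟩

end Valid

variable (T) in
/-- The syndrome of a vector, as a natural number. -/
noncomputable def syndrome (x : Fin 15 → ZMod 2) : ℕ := Function.invFun bitSeq (T.syndromeMap x)

namespace Valid

theorem bitSeq_syndrome (hT : T.Valid e) (x : Fin 15 → ZMod 2) :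
    bitSeq (T.syndrome x) = T.syndromeMap x := by
  obtain ⟨z, -, h⟩ := hT.exists_syndrome x
  rw [syndrome, h, Function.leftInverse_invFun bitSeq_injective]

theorem syndrome_lt (hT : T.Valid e) (x : Fin 15 → ZMod 2) :
    T.syndrome x < 2 ^ T.lifts.length := by
  obtain ⟨z, hz, h⟩ := hT.exists_syndrome x
  rwa [bitSeq_injective ((hT.bitSeq_syndrome x).trans h)]

theorem syndrome_eq (hT : T.Valid e) {x : Fin 15 → ZMod 2} {z : ℕ}
    (h : T.syndromeMap x = bitSeq z) : T.syndrome x = z :=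
  bitSeq_injective ((hT.bitSeq_syndrome x).trans h)

theorem syndrome_add (hT : T.Valid e) (x y : Fin 15 → ZMod 2) :
    T.syndrome (x + y) = T.syndrome x ^^^ T.syndrome y :=
  hT.syndrome_eq <| by
    rw [map_add, bitSeq_xor, hT.bitSeq_syndrome, hT.bitSeq_syndrome]

/-- The prepended `0` is the syndrome of making no change, which shifts the coordinates by one. -/
theorem syndrome_unitOrZero (hT : T.Valid e) (o : Option (Fin 15)) :
    T.syndrome (unitOrZero o) = (0 :: T.cols).getD (o.elim 0 fun i => (i : ℕ) + 1) 0 := by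
  refine hT.syndrome_eq ?_
  cases o with
  | none => simp [unitOrZero]
  | some i => simpa [unitOrZero] using T.syndromeMap_single i

theorem coe_nibbleMap (hT : T.Valid e) {w : ℕ × ℕ} (hw : w ∈ T.words) (i : Fin 15) :
    (nibbleMap w.2 i : ℕ) = nibble w.2 i :=
  Nat.mod_eq_of_lt (hT.nibble_lt w hw i i.2)

theorem permOf_apply (hT : T.Valid e) {w : ℕ × ℕ} (hw : w ∈ T.words) (i : Fin 15) :
    permOf w.2 i = nibbleMap w.2 i := by
  have h : Function.Bijective (nibbleMap w.2) := by
    refine (Finite.injective_iff_bijective.1 (Finite.injective_iff_surjective.2 fun i => ?_))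
    obtain ⟨j, hj, h⟩ := hT.nibble_surj w hw i i.2
    exact ⟨⟨j, hj⟩, Fin.ext ((hT.coe_nibbleMap hw _).trans h)⟩
  rw [permOf, dif_pos h, Equiv.ofBijective_apply]

/-- Both sides are linear in `x`, so the fifteen checked columns suffice. In particular the
permutation preserves the kernel of the syndrome map and acts on cosets. -/
theorem syndromeMap_comp_permOf (hT : T.Valid e) {w : ℕ × ℕ} (hw : w ∈ T.words)
    (x : Fin 15 → ZMod 2) :
    T.syndromeMap (x ∘ (permOf w.2).symm) = colMap (T.action w.2) (T.syndromeMap x) := by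
  have : T.syndromeMap.comp (LinearMap.funLeft (ZMod 2) (ZMod 2) (permOf w.2).symm) =
      (colMap (T.action w.2)).comp T.syndromeMap := by
    refine LinearMap.pi_ext' fun i => LinearMap.ext_ring ?_
    have h : (Pi.single i 1 : Fin 15 → ZMod 2) ∘ (permOf w.2).symm =
        Pi.single (permOf w.2 i) 1 := by
      funext j
      simp [Pi.single_apply, Equiv.symm_apply_eq]
    simp only [LinearMap.comp_apply, LinearMap.single_apply]
    change T.syndromeMap ((Pi.single i 1 : Fin 15 → ZMod 2) ∘ (permOf w.2).symm) = _
    rw [h, syndromeMap_single, syndromeMap_single, colMap_bitSeq, hT.action_col w hw i i.2,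
      hT.permOf_apply hw, hT.coe_nibbleMap hw]
  exact LinearMap.congr_fun this x

theorem syndrome_star (hT : T.Valid e) {w : ℕ × ℕ} (hw : w ∈ T.words)
    (x y : Fin 15 → ZMod 2) :
    T.syndrome (x + y ∘ (permOf w.2).symm) =
      T.syndrome x ^^^ xorCols (T.action w.2) (T.syndrome y) := by
  rw [hT.syndrome_add]
  congr 1
  refine hT.syndrome_eq ?_
  rw [hT.syndromeMap_comp_permOf hw, ← hT.bitSeq_syndrome, colMap_bitSeq]

/-- The code consisting of the vectors whose syndrome is listed in the table. -/
noncomputable def code (hT : T.Valid e) : PropelinearPerfectCode (Fin 15) where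
  carrier := {x | lookupWord T.words (T.syndrome x) ≠ 0}
  perm x := permOf (lookupWord T.words (T.syndrome x))
  zero_mem := by
    have h : T.syndrome 0 = 0 := hT.syndrome_eq (by simp)
    rw [Set.mem_ofPred_eq, h]
    exact (hT.has_iff 0 (by positivity)).1 hT.has_zero
  perfect x := by
    obtain ⟨o, ho, h⟩ := hT.perfect _ (hT.syndrome_lt x)
    have key : ∀ p : Option (Fin 15), x + unitOrZero p ∈
        {x | lookupWord T.words (T.syndrome x) ≠ 0} ↔
          (p.elim 0 fun i => (i : ℕ) + 1) = o := by
      intro p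
      rw [Set.mem_ofPred_eq, ← hT.has_iff _ (hT.syndrome_lt _), hT.syndrome_add,
        hT.syndrome_unitOrZero]
      refine h _ ?_
      cases p with
      | none => simp
      | some i => simp only [Option.elim_some]; omega
    simp only [key]
    cases o with
    | zero =>
      refine ⟨none, rfl, ?_⟩
      rintro (_ | i) hi
      · rfl
      · simp at hi
    | succ o =>
      refine ⟨some ⟨o, by omega⟩, rfl, ?_⟩
      rintro (_ | i) hi
      · simp at hi
      · simp only [Option.elim_some, Nat.add_right_cancel_iff] at hi
        exact congrArg some (Fin.ext hi)
  star_mem x hx y hy := by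
    have hw := mem_of_lookupWord_ne hx
    have ht := mem_of_lookupWord_ne hy
    have := hT.star_ne _ hw _ ht
    rw [← hT.syndrome_star hw] at this
    exact this
  perm_star x hx y hy := by
    have hw := mem_of_lookupWord_ne hx
    have ht := mem_of_lookupWord_ne hy
    have h1 := hT.star_ne _ hw _ ht
    have h2 := hT.star_nibble _ hw _ ht
    rw [← hT.syndrome_star hw] at h1 h2
    have hr := mem_of_lookupWord_ne h1
    ext i
    rw [hT.permOf_apply hr, hT.coe_nibbleMap hr, Equiv.Perm.mul_apply, hT.permOf_apply ht,
      hT.permOf_apply hw, hT.coe_nibbleMap hw, hT.coe_nibbleMap ht]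
    exact h2 i i.2

theorem mem_code (hT : T.Valid e) {x : Fin 15 → ZMod 2} :
    x ∈ hT.code.carrier ↔ T.has (T.syndrome x) = true :=
  (hT.has_iff _ (hT.syndrome_lt x)).symm

/-- The chosen vector with the given unit vector as its syndrome. -/
noncomputable def lift (T : SyndromeTable) (j : ℕ) : Fin 15 → ZMod 2 :=
  fun i => bitSeq (T.lifts.getD j 0) i

theorem syndromeMap_lift (hT : T.Valid e) {j : ℕ} (hj : j < T.lifts.length) :
    T.syndromeMap (lift T j) = Pi.single j 1 := by
  have := colMap_eq_sum T.cols hT.length_cols (bitSeq (T.lifts.getD j 0))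
  rw [colMap_bitSeq, hT.lifts_spec j hj, bitSeq_two_pow] at this
  rw [this, syndromeMap, Fintype.linearCombination_apply]
  rfl

/-- The span is the kernel of `ρ`, which reads the last `d` bits of the syndrome: codewords have
only the first `e` bits, and the code contains all vectors with syndrome `0` or one of the first `e`
unit vectors. The lifts make `ρ` surjective. -/
theorem rank_code (hT : T.Valid e) {d : ℕ} (hd : e + d = T.lifts.length) :
    hT.code.rank + d = 15 := by
  let ρ : (Fin 15 → ZMod 2) →ₗ[ZMod 2] (Fin d → ZMod 2) :=
    (LinearMap.funLeft (ZMod 2) (ZMod 2) fun k : Fin d => e + k).comp T.syndromeMap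
  have hρ : ∀ x k, ρ x k = T.syndromeMap x (e + k) := fun _ _ => rfl
  have hsurj : LinearMap.range ρ = ⊤ := by
    refine LinearMap.range_eq_top.2 fun a => ⟨∑ k : Fin d, a k • lift T (e + k), ?_⟩
    funext k
    have : ∀ i : Fin d, T.syndromeMap (lift T (e + i)) = Pi.single (e + (i : ℕ)) 1 :=
      fun i => hT.syndromeMap_lift (by omega)
    rw [hρ, map_sum]
    simp only [map_smul, this, Finset.sum_apply, Pi.smul_apply, Pi.single_apply, smul_eq_mul,
      Nat.add_left_cancel_iff, Fin.val_inj]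
    simp
  have hker : LinearMap.ker ρ = Submodule.span (ZMod 2) hT.code.carrier := by
    apply le_antisymm
    · intro x hx
      have hx' : ∀ j, e ≤ j → T.syndromeMap x j = 0 := by
        intro j hj
        rcases lt_or_ge j T.lifts.length with h | h
        · have := congrFun (LinearMap.mem_ker.1 hx) ⟨j - e, by omega⟩
          rw [hρ] at this
          simpa [Nat.add_sub_cancel' hj] using this
        · rw [← hT.bitSeq_syndrome]
          exact bitSeq_eq_zero_of_lt (hT.syndrome_lt x) h
      -- Subtracting the lifts of the first `e` bits leaves syndrome zero, hence a codeword.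
      have h0 : T.syndromeMap (x - ∑ j : Fin e, T.syndromeMap x j • lift T j) = 0 := by
        have : ∀ i : Fin e, T.syndromeMap (lift T i) = Pi.single (i : ℕ) 1 :=
          fun i => hT.syndromeMap_lift (by omega)
        funext j
        simp only [map_sub, map_sum, map_smul, this, Pi.sub_apply, Finset.sum_apply,
          Pi.smul_apply, Pi.single_apply, smul_eq_mul, Pi.zero_apply]
        rcases lt_or_ge j e with h | h
        · rw [Finset.sum_eq_single (⟨j, h⟩ : Fin e)]
          · simp
          · intro b _ hb
            rw [if_neg, mul_zero]
            exact fun h' => hb (Fin.ext h'.symm)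
          · simp
        · rw [Finset.sum_eq_zero, hx' j h, sub_zero]
          intro i _
          rw [if_neg (by omega), mul_zero]
      have hmem : x - ∑ j : Fin e, T.syndromeMap x j • lift T j ∈ hT.code.carrier := by
        rw [mem_code, hT.syndrome_eq (z := 0) (by rw [h0, bitSeq_zero])]
        exact hT.has_zero
      rw [← sub_add_cancel x (∑ j : Fin e, T.syndromeMap x j • lift T j)]
      refine add_mem (Submodule.subset_span hmem) (sum_mem fun j _ => Submodule.smul_mem _ _ ?_)
      refine Submodule.subset_span ?_
      rw [mem_code, hT.syndrome_eq (z := 2 ^ (j : ℕ))]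
      · exact hT.has_two_pow j j.2
      · rw [hT.syndromeMap_lift (by omega), bitSeq_two_pow]
    · refine Submodule.span_le.2 fun x hx => LinearMap.mem_ker.2 ?_
      funext k
      rw [hρ, ← hT.bitSeq_syndrome]
      exact bitSeq_eq_zero_of_lt (hT.words_lt _ (mem_of_lookupWord_ne hx)) (by omega)
  have := LinearMap.finrank_range_add_finrank_ker ρ
  rw [hsurj, hker, finrank_top, Module.finrank_fin_fun, Module.finrank_fin_fun] at this
  rw [PropelinearPerfectCode.rank]
  omega

end Valid
end SyndromeTable

/-! ### Vasil'ev doubling -/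

namespace PropelinearPerfectCode

section Doubling

variable {ι : Type}

/-- The permutation of `ι × ZMod 2` and a further point that lifts `π` and adds `b` to the second
component. -/
def doublePerm (π : Equiv.Perm ι) (b : ι → ZMod 2) : Equiv.Perm (Option (ι × ZMod 2)) where
  toFun p := p.map fun q => (π q.1, q.2 + b (π q.1))
  invFun p := p.map fun q => (π.symm q.1, q.2 + b q.1)
  left_inv p := by
    cases p with
    | none => rfl
    | some q => simp [add_assoc, CharTwo.add_self_eq_zero]
  right_inv p := by
    cases p with
    | none => rfl
    | some q => simp [add_assoc, CharTwo.add_self_eq_zero]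

theorem doublePerm_symm_some (π : Equiv.Perm ι) (b : ι → ZMod 2) (i : ι) (ε : ZMod 2) :
    (doublePerm π b).symm (some (i, ε)) = some (π.symm i, ε + b i) := rfl

theorem doublePerm_symm_none (π : Equiv.Perm ι) (b : ι → ZMod 2) :
    (doublePerm π b).symm none = none := rfl

/-- A semidirect product law: the lifted permutations compose correctly precisely when the swaps
form a crossed homomorphism, hence `corr_star`. -/
theorem doublePerm_mul (π τ : Equiv.Perm ι) (b c : ι → ZMod 2) :
    doublePerm π b * doublePerm τ c = doublePerm (π * τ) (b + c ∘ π.symm) := by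
  ext1 p
  cases p with
  | none => rfl
  | some q =>
    simp [doublePerm, add_comm, add_left_comm]

/-- The sum of the two halves of a vector of the doubled space. -/
def halfSum : (Option (ι × ZMod 2) → ZMod 2) →ₗ[ZMod 2] (ι → ZMod 2) where
  toFun v i := v (some (i, 0)) + v (some (i, 1))
  map_add' u v := by
    funext i
    simp only [Pi.add_apply]
    abel
  map_smul' a v := by
    funext i
    simp [mul_add]

theorem halfSum_apply (v : Option (ι × ZMod 2) → ZMod 2) (i : ι) :
    halfSum v i = v (some (i, 0)) + v (some (i, 1)) := rfl

theorem halfSum_comp_doublePerm (π : Equiv.Perm ι) (b : ι → ZMod 2)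
    (v : Option (ι × ZMod 2) → ZMod 2) :
    halfSum (v ∘ (doublePerm π b).symm) = halfSum v ∘ π.symm := by
  funext i
  simp only [halfSum_apply, Function.comp_apply, doublePerm_symm_some]
  have : ∀ a : ZMod 2, a = 0 ∨ a = 1 := by decide
  rcases this (b i) with h | h
  · rw [h, add_zero, add_zero]
  · rw [h, zero_add, CharTwo.add_self_eq_zero, add_comm]

variable [Fintype ι]

/-- The parity check of the Vasil'ev construction, without its nonlinear part. -/
def halfParity : (Option (ι × ZMod 2) → ZMod 2) →ₗ[ZMod 2] ZMod 2 where
  toFun v := v none + ∑ i, v (some (i, 1))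
  map_add' u v := by
    simp only [Pi.add_apply, Finset.sum_add_distrib]
    abel
  map_smul' a v := by
    simp [mul_add, Finset.mul_sum]

theorem halfParity_apply (v : Option (ι × ZMod 2) → ZMod 2) :
    halfParity v = v none + ∑ i, v (some (i, 1)) := rfl

/-- Swapping a pair replaces one entry by the other in the parity, a change by the sum of the pair.
This is the linear term in `map_star`. -/
theorem halfParity_comp_doublePerm (π : Equiv.Perm ι) (b : ι → ZMod 2)
    (v : Option (ι × ZMod 2) → ZMod 2) :
    halfParity (v ∘ (doublePerm π b).symm) =
      halfParity v + ∑ i, b i * halfSum v (π.symm i) := by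
  simp only [halfParity_apply, halfSum_apply, Function.comp_apply, doublePerm_symm_some,
    doublePerm_symm_none]
  rw [add_assoc, ← Equiv.sum_comp π.symm fun i => v (some (i, 1)), ← Finset.sum_add_distrib]
  congr 1
  refine Finset.sum_congr rfl fun i _ => ?_
  have : ∀ a : ZMod 2, a = 0 ∨ a = 1 := by decide
  rcases this (b i) with h | h
  · simp [h]
  · rw [h, CharTwo.add_self_eq_zero, one_mul, add_left_comm, CharTwo.add_self_eq_zero, add_zero]

end Doubling

section Doubling

variable {ι : Type} [DecidableEq ι]

theorem halfSum_unitOrZero_some (i : ι) (ε : ZMod 2) :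
    halfSum (unitOrZero (some (some (i, ε)))) = unitOrZero (some i) := by
  funext j
  have : ∀ a : ZMod 2, a = 0 ∨ a = 1 := by decide
  rcases this ε with h | h <;> by_cases hj : j = i <;>
    simp [halfSum_apply, unitOrZero, h, hj]

theorem halfSum_unitOrZero_none :
    halfSum (unitOrZero (some (none : Option (ι × ZMod 2)))) = 0 := by
  funext j
  simp [halfSum_apply, unitOrZero]

variable [Fintype ι]

theorem halfParity_unitOrZero_some (i : ι) (ε : ZMod 2) :
    halfParity (unitOrZero (some (some (i, ε)))) = ε := by
  have : ∀ a : ZMod 2, a = 0 ∨ a = 1 := by decide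
  rcases this ε with h | h <;>
    simp [halfParity_apply, unitOrZero, Pi.single_apply, h]

theorem halfParity_unitOrZero_none :
    halfParity (unitOrZero (some (none : Option (ι × ZMod 2)))) = 1 := by
  simp [halfParity_apply, unitOrZero]

end Doubling

variable {ι : Type} [Fintype ι] [DecidableEq ι] (C : PropelinearPerfectCode ι)

/-- The propelinear operation on the ambient space. -/
def star (x y : ι → ZMod 2) : ι → ZMod 2 := x + y ∘ (C.perm x).symm

/-- A function on a propelinear code which, up to linear functions, is a homomorphism, the
correction terms forming a crossed homomorphism. -/
structure QuasiHom where
  toFun : (ι → ZMod 2) → ZMod 2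
  corr : (ι → ZMod 2) → ι → ZMod 2
  map_zero : toFun 0 = 0
  map_star : ∀ x ∈ C.carrier, ∀ y ∈ C.carrier,
    toFun (C.star x y) = toFun x + toFun y + ∑ i, corr x i * y ((C.perm x).symm i)
  corr_star : ∀ x ∈ C.carrier, ∀ y ∈ C.carrier,
    corr (C.star x y) = corr x + corr y ∘ (C.perm x).symm

/-- The zero function. -/
def zeroQuasiHom : C.QuasiHom where
  toFun _ := 0
  corr _ := 0
  map_zero := rfl
  map_star _ _ _ _ := by simp
  corr_star _ _ _ _ := by simp

variable {C}

/-- The Vasil'ev code. -/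
def vasilev (f : C.QuasiHom) : PropelinearPerfectCode (Option (ι × ZMod 2)) where
  carrier := {v | halfSum v ∈ C.carrier ∧ halfParity v = f.toFun (halfSum v)}
  perm v := doublePerm (C.perm (halfSum v)) (f.corr (halfSum v))
  zero_mem := by
    refine ⟨?_, ?_⟩
    · rw [map_zero]; exact C.zero_mem
    · rw [map_zero, map_zero, f.map_zero]
  perfect v := by
    have h2 : ∀ a b : ZMod 2, a ≠ b → a + 1 = b := by decide
    have h3 : ∀ a b : ZMod 2, a + 1 = b → a ≠ b := by decide
    have hz : (unitOrZero none : ι → ZMod 2) = 0 := rfl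
    have hz' : (unitOrZero none : Option (ι × ZMod 2) → ZMod 2) = 0 := rfl
    obtain ⟨o, ho, huniq⟩ := C.perfect (halfSum v)
    cases o with
    -- The sum of halves is already in `C`, so only the extra coordinate may be flipped, and the
    -- parity decides whether it is.
    | none =>
      have ho' : halfSum v ∈ C.carrier := by simpa [hz] using ho
      have hno : ∀ i ε, ¬ halfSum (v + unitOrZero (some (some (i, ε)))) ∈ C.carrier := by
        intro i ε h
        rw [map_add, halfSum_unitOrZero_some] at h
        simpa using huniq _ h
      by_cases hp : halfParity v = f.toFun (halfSum v)
      · refine ⟨none, ⟨by simpa [hz'] using ho', by simpa [hz'] using hp⟩, ?_⟩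
        rintro (_ | _ | ⟨i, ε⟩) h
        · rfl
        · have := h.2
          rw [map_add, map_add, halfSum_unitOrZero_none, halfParity_unitOrZero_none,
            add_zero] at this
          exact absurd hp (h3 _ _ this)
        · exact absurd h.1 (hno i ε)
      · refine ⟨some none, ⟨?_, ?_⟩, ?_⟩
        · rwa [map_add, halfSum_unitOrZero_none, add_zero]
        · rw [map_add, map_add, halfSum_unitOrZero_none, halfParity_unitOrZero_none, add_zero]
          exact h2 _ _ hp
        · rintro (_ | _ | ⟨i, ε⟩) h
          · exact absurd (by simpa [hz'] using h.2) hp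
          · rfl
          · exact absurd h.1 (hno i ε)
    | some i =>
      have hno : ∀ o, (o = none ∨ o = some none) →
          ¬ halfSum (v + unitOrZero o) ∈ C.carrier := by
        rintro o ho h
        have h0 : halfSum (unitOrZero o : Option (ι × ZMod 2) → ZMod 2) = 0 := by
          rcases ho with rfl | rfl
          · rw [hz', map_zero]
          · exact halfSum_unitOrZero_none
        rw [map_add, h0] at h
        exact absurd (huniq none h) (by simp)
      -- The position `i` is forced by `C`; the half to flip is the unique solution of the parity
      -- equation.
      refine ⟨some (some (i, halfParity v + f.toFun (halfSum v + unitOrZero (some i)))),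
        ⟨?_, ?_⟩, ?_⟩
      · rwa [map_add, halfSum_unitOrZero_some]
      · rw [map_add, map_add, halfSum_unitOrZero_some, halfParity_unitOrZero_some, ← add_assoc,
          CharTwo.add_self_eq_zero, zero_add]
      · rintro (_ | _ | ⟨j, ε⟩) h
        · exact absurd h.1 (hno _ (Or.inl rfl))
        · exact absurd h.1 (hno _ (Or.inr rfl))
        · obtain ⟨h1, h4⟩ := h
          rw [map_add, halfSum_unitOrZero_some] at h1
          rw [map_add, map_add, halfSum_unitOrZero_some, halfParity_unitOrZero_some] at h4
          have hj := huniq _ h1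
          rw [Option.some_inj] at hj
          subst hj
          rw [← h4, ← add_assoc, CharTwo.add_self_eq_zero, zero_add]
  star_mem x hx y hy := by
    have h1 : halfSum (x + y ∘ (doublePerm (C.perm (halfSum x)) (f.corr (halfSum x))).symm) =
        C.star (halfSum x) (halfSum y) := by
      rw [map_add, halfSum_comp_doublePerm]; rfl
    refine ⟨?_, ?_⟩
    · rw [h1]
      exact C.star_mem _ hx.1 _ hy.1
    · rw [h1, map_add, halfParity_comp_doublePerm, f.map_star _ hx.1 _ hy.1, hx.2, hy.2,
        add_assoc]
  perm_star x hx y hy := by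
    have h1 : halfSum (x + y ∘ (doublePerm (C.perm (halfSum x)) (f.corr (halfSum x))).symm) =
        C.star (halfSum x) (halfSum y) := by
      rw [map_add, halfSum_comp_doublePerm]; rfl
    rw [h1, f.corr_star _ hx.1 _ hy.1, doublePerm_mul]
    congr 1
    exact C.perm_star _ hx.1 _ hy.1

end PropelinearPerfectCode

/-! ### Ranks of Vasil'ev codes -/

namespace PropelinearPerfectCode

section Rank

variable {ι : Type} [Fintype ι]

/-- The vector of the doubled space with given sum of halves, second half and parity. -/
def assemble : ((ι → ZMod 2) × (ι → ZMod 2)) × ZMod 2 →ₗ[ZMod 2]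
    (Option (ι × ZMod 2) → ZMod 2) where
  toFun p o := o.elim (∑ i, p.1.2 i + p.2) fun q =>
    if q.2 = 0 then p.1.1 q.1 + p.1.2 q.1 else p.1.2 q.1
  map_add' p q := by
    funext o
    rcases o with _ | ⟨i, ε⟩
    · simp [Finset.sum_add_distrib, add_add_add_comm]
    · by_cases h : ε = 0 <;> simp [h, add_add_add_comm]
  map_smul' a p := by
    funext o
    rcases o with _ | ⟨i, ε⟩
    · simp [Finset.mul_sum, mul_add]
    · by_cases h : ε = 0 <;> simp [h, mul_add]

theorem halfSum_assemble (p : ((ι → ZMod 2) × (ι → ZMod 2)) × ZMod 2) :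
    halfSum (assemble p) = p.1.1 := by
  funext i
  simp [halfSum_apply, assemble, add_assoc, CharTwo.add_self_eq_zero]

theorem halfParity_assemble (p : ((ι → ZMod 2) × (ι → ZMod 2)) × ZMod 2) :
    halfParity (assemble p) = p.2 := by
  have h : (∑ i, p.1.2 i + p.2) + ∑ i, p.1.2 i = p.2 := by
    rw [add_right_comm, CharTwo.add_self_eq_zero, zero_add]
  simpa [halfParity_apply, assemble] using h

theorem assemble_half (v : Option (ι × ZMod 2) → ZMod 2) :
    assemble ((halfSum v, fun i => v (some (i, 1))), halfParity v) = v := by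
  funext o
  have : ∀ a : ZMod 2, a = 0 ∨ a = 1 := by decide
  rcases o with _ | ⟨i, ε⟩
  · simp [halfParity_apply, assemble, add_left_comm, CharTwo.add_self_eq_zero]
  · rcases this ε with rfl | rfl
    · simp [assemble, halfSum_apply, add_assoc, CharTwo.add_self_eq_zero]
    · simp [assemble]

variable [DecidableEq ι] {C : PropelinearPerfectCode ι}

theorem assemble_mem_vasilev (f : C.QuasiHom) {y : ι → ZMod 2} (hy : y ∈ C.carrier)
    (w : ι → ZMod 2) : assemble ((y, w), f.toFun y) ∈ (vasilev f).carrier := by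
  refine ⟨?_, ?_⟩
  · rwa [halfSum_assemble]
  · rw [halfParity_assemble, halfSum_assemble]

/-- In the coordinates of `assemble` the code is `C` times the free second halves, with parity zero.
Since `0 ∈ C`, its span is the span of `C` times the full space. -/
theorem rank_vasilev_zero (C : PropelinearPerfectCode ι) :
    (vasilev C.zeroQuasiHom).rank = C.rank + Fintype.card ι := by
  have hmem : ∀ {y}, y ∈ C.carrier → ∀ w, assemble ((y, w), 0) ∈
      (vasilev C.zeroQuasiHom).carrier := fun hy w => assemble_mem_vasilev C.zeroQuasiHom hy w
  let g : (Submodule.span (ZMod 2) C.carrier × (ι → ZMod 2)) →ₗ[ZMod 2]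
      (Option (ι × ZMod 2) → ZMod 2) :=
    assemble.comp ((LinearMap.inl (ZMod 2) _ _).comp
      ((Submodule.span (ZMod 2) C.carrier).subtype.prodMap LinearMap.id))
  have hg : ∀ p, g p = assemble ((p.1, p.2), 0) := fun _ => rfl
  have hinj : Function.Injective g := by
    refine (injective_iff_map_eq_zero g).2 fun p hp => ?_
    rw [hg] at hp
    have h1 : (p.1 : ι → ZMod 2) = 0 := by
      have := halfSum_assemble ((p.1, p.2), (0 : ZMod 2))
      rw [hp, map_zero] at this
      exact this.symm
    have h2 : p.2 = 0 := by
      funext i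
      simpa [assemble] using congrFun hp (some (i, 1))
    exact Prod.ext (Subtype.ext h1) h2
  have hrange : LinearMap.range g =
      Submodule.span (ZMod 2) (vasilev C.zeroQuasiHom).carrier := by
    apply le_antisymm
    · rintro _ ⟨⟨⟨y, hy⟩, w⟩, rfl⟩
      let L : (ι → ZMod 2) →ₗ[ZMod 2] (Option (ι × ZMod 2) → ZMod 2) :=
        assemble.comp ((LinearMap.inl (ZMod 2) _ _).comp (LinearMap.inl (ZMod 2) _ _))
      have hL : ∀ y, L y = assemble ((y, 0), 0) := fun _ => rfl
      have h1 : L y ∈ Submodule.span (ZMod 2) (vasilev C.zeroQuasiHom).carrier := by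
        rw [← Submodule.mem_comap]
        refine Submodule.span_le.2 (fun z hz => ?_) hy
        rw [SetLike.mem_coe, Submodule.mem_comap, hL]
        exact Submodule.subset_span (hmem hz 0)
      have h2 : assemble ((0, w), 0) ∈
          Submodule.span (ZMod 2) (vasilev C.zeroQuasiHom).carrier :=
        Submodule.subset_span (hmem C.zero_mem w)
      have h3 : ((((y, w), 0) : ((ι → ZMod 2) × (ι → ZMod 2)) × ZMod 2)) =
          ((y, 0), 0) + ((0, w), 0) := by
        ext <;> simp
      rw [hg, h3, map_add, ← hL]
      exact add_mem h1 h2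
    · refine Submodule.span_le.2 fun v hv => ?_
      refine ⟨(⟨halfSum v, Submodule.subset_span hv.1⟩, fun i => v (some (i, 1))), ?_⟩
      have h := assemble_half v
      rw [hv.2] at h
      exact h
  rw [rank, ← hrange, LinearMap.finrank_range_of_inj hinj, Module.finrank_prod,
    Module.finrank_fintype_fun_eq_card, rank]

/-- A functional vanishing on the code ignores the second half, so it has the form `α y + s * c`
with `s` the parity. If `c = 0`, then `α` vanishes on the spanning set `C`; if `c = 1`, then `f`
equals `α` on `C`. -/
theorem span_vasilev_eq_top {f : C.QuasiHom} (hC : Submodule.span (ZMod 2) C.carrier = ⊤)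
    (hf : ∀ ψ : (ι → ZMod 2) →ₗ[ZMod 2] ZMod 2, ∃ y ∈ C.carrier, f.toFun y ≠ ψ y) :
    Submodule.span (ZMod 2) (vasilev f).carrier = ⊤ := by
  by_contra hne
  obtain ⟨φ, hφ0, hφ⟩ := Submodule.exists_le_ker_of_lt_top _ (lt_top_iff_ne_top.2 hne)
  have hv : ∀ y ∈ C.carrier, ∀ w, φ (assemble ((y, w), f.toFun y)) = 0 := fun y hy w =>
    hφ (Submodule.subset_span (assemble_mem_vasilev f hy w))
  let α : (ι → ZMod 2) →ₗ[ZMod 2] ZMod 2 :=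
    φ.comp (assemble.comp ((LinearMap.inl (ZMod 2) _ _).comp (LinearMap.inl (ZMod 2) _ _)))
  have hα : ∀ y, α y = φ (assemble ((y, 0), 0)) := fun _ => rfl
  have hβ : ∀ w, φ (assemble ((0, w), 0)) = 0 := fun w => by
    simpa only [f.map_zero] using hv 0 C.zero_mem w
  have hsplit : ∀ y w s, φ (assemble ((y, w), s)) = α y + s * φ (assemble ((0, 0), 1)) := by
    intro y w s
    have : (((y, w), s) : ((ι → ZMod 2) × (ι → ZMod 2)) × ZMod 2) =
        ((y, 0), 0) + ((0, w), 0) + s • ((0, 0), 1) := by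
      ext <;> simp
    rw [this, map_add, map_add, map_add, map_add, hβ, map_smul, map_smul, hα, add_zero,
      smul_eq_mul]
  have h01 : ∀ a : ZMod 2, a = 0 ∨ a = 1 := by decide
  rcases h01 (φ (assemble ((0, 0), 1))) with h | h
  · have hα0 : α = 0 := by
      refine LinearMap.ext_on hC fun y hy => ?_
      have := hv y hy 0
      rwa [hsplit, h, mul_zero, add_zero] at this
    refine hφ0 (LinearMap.ext fun v => ?_)
    rw [← assemble_half v, hsplit, h, hα0, mul_zero, add_zero]
    rfl
  · obtain ⟨y, hy, hne⟩ := hf α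
    have := hv y hy 0
    rw [hsplit, h, mul_one] at this
    exact hne (CharTwo.add_eq_zero.1 this).symm

end Rank

/-! ### Sphere packing and the group structure of the code -/

section Counting

variable {ι : Type} [Fintype ι] [DecidableEq ι] (C : PropelinearPerfectCode ι)

/-- The balls of radius one around the codewords partition the space. -/
theorem natCard_carrier : Nat.card C.carrier * (Fintype.card ι + 1) = 2 ^ Fintype.card ι := by
  have hb : Function.Bijective
      fun p : C.carrier × Option ι => (p.1 : ι → ZMod 2) + unitOrZero p.2 := by
    have hcancel : ∀ a b : ι → ZMod 2, a + b + b = a := fun a b => by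
      funext i
      simp [add_assoc, CharTwo.add_self_eq_zero]
    refine ⟨?_, fun x => ?_⟩
    · rintro ⟨⟨c, hc⟩, o⟩ ⟨⟨d, hd⟩, p⟩ h
      simp only at h
      have hp : o = p := by
        refine (C.perfect (c + unitOrZero o)).unique ?_ ?_
        · rwa [hcancel]
        · rwa [h, hcancel]
      subst hp
      have := add_right_cancel h
      subst this
      rfl
    · obtain ⟨o, ho, -⟩ := C.perfect x
      exact ⟨(⟨_, ho⟩, o), hcancel _ _⟩
  have := Nat.card_congr (Equiv.ofBijective _ hb)
  rwa [Nat.card_prod, Nat.card_eq_fintype_card (α := Option ι), Fintype.card_option,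
    Nat.card_fun, Nat.card_zmod, Nat.card_eq_fintype_card (α := ι)] at this

theorem star_assoc {x y : ι → ZMod 2} (hx : x ∈ C.carrier) (hy : y ∈ C.carrier)
    (z : ι → ZMod 2) : C.star (C.star x y) z = C.star x (C.star y z) := by
  have h : C.perm (C.star x y) = C.perm x * C.perm y := C.perm_star x hx y hy
  funext i
  simp only [star, Pi.add_apply, Function.comp_apply] at h ⊢
  rw [h, add_assoc]
  rfl

theorem star_zero (x : ι → ZMod 2) : C.star x 0 = x := by
  rw [star, Pi.zero_comp, add_zero]

theorem star_injective (x : ι → ZMod 2) : Function.Injective (C.star x) := fun _ _ h =>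
  (C.perm x).symm.surjective.injective_comp_right (add_left_cancel h)

theorem exists_star_eq {x z : ι → ZMod 2} (hx : x ∈ C.carrier) (hz : z ∈ C.carrier) :
    ∃ y ∈ C.carrier, C.star x y = z := by
  let g : C.carrier → C.carrier := fun y => ⟨C.star x y, C.star_mem x hx y y.2⟩
  have hg : Function.Injective g := fun a b h =>
    Subtype.ext (C.star_injective x (congrArg Subtype.val h))
  obtain ⟨y, hy⟩ := Finite.injective_iff_surjective.1 hg ⟨z, hz⟩
  exact ⟨y, y.2, congrArg Subtype.val hy⟩

end Counting

end PropelinearPerfectCode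

namespace PropelinearPerfectCode

variable {ι : Type} [Fintype ι] [DecidableEq ι]

/-- A propelinear code as a group under the propelinear operation. -/
def CodeGroup (C : PropelinearPerfectCode ι) : Type := C.carrier

namespace CodeGroup

variable {C : PropelinearPerfectCode ι}

/-- The codeword underlying an element of the group. -/
def word (x : C.CodeGroup) : ι → ZMod 2 := Subtype.val x

theorem word_mem (x : C.CodeGroup) : x.word ∈ C.carrier := Subtype.property x

theorem word_injective : Function.Injective (word : C.CodeGroup → ι → ZMod 2) :=
  Subtype.val_injective

/-- A codeword as an element of the group. -/
def ofWord {x : ι → ZMod 2} (hx : x ∈ C.carrier) : C.CodeGroup := ⟨x, hx⟩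

theorem word_ofWord {x : ι → ZMod 2} (hx : x ∈ C.carrier) : (ofWord hx).word = x := rfl

instance : Finite C.CodeGroup := inferInstanceAs (Finite C.carrier)

instance : Mul C.CodeGroup := ⟨fun x y => ofWord (C.star_mem _ x.word_mem _ y.word_mem)⟩

instance : One C.CodeGroup := ⟨ofWord C.zero_mem⟩

theorem word_mul (x y : C.CodeGroup) : (x * y).word = C.star x.word y.word := rfl

theorem word_one : (1 : C.CodeGroup).word = 0 := rfl

noncomputable instance : Inv C.CodeGroup :=
  ⟨fun x => ofWord (C.exists_star_eq x.word_mem C.zero_mem).choose_spec.1⟩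

noncomputable instance : Group C.CodeGroup :=
  Group.ofRightAxioms
    (fun x y z => word_injective (C.star_assoc x.word_mem y.word_mem z.word))
    (fun x => word_injective (C.star_zero x.word))
    (fun x => word_injective (C.exists_star_eq x.word_mem C.zero_mem).choose_spec.2)

theorem isPGroup : IsPGroup 2 C.CodeGroup :=
  IsPGroup.of_card_dvd_pow (n := Fintype.card ι) ⟨_, C.natCard_carrier.symm⟩

variable (C) in
/-- The restriction to the code of an affine function. -/
def affine : (ι → ZMod 2) × ZMod 2 →ₗ[ZMod 2] (C.CodeGroup → ZMod 2) where
  toFun p y := ∑ i, p.1 i * y.word i + p.2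
  map_add' p q := by
    funext y
    simp only [Prod.fst_add, Prod.snd_add, Pi.add_apply, add_mul, Finset.sum_add_distrib]
    exact add_add_add_comm _ _ _ _
  map_smul' a p := by
    funext y
    simp [Finset.mul_sum, mul_add, mul_assoc]

theorem affine_apply (p : (ι → ZMod 2) × ZMod 2) (y : C.CodeGroup) :
    affine C p y = ∑ i, p.1 i * y.word i + p.2 := rfl

/-- Translation of the functions on the group. -/
noncomputable def translate (g : C.CodeGroup) :
    (C.CodeGroup → ZMod 2) →ₗ[ZMod 2] (C.CodeGroup → ZMod 2) :=
  LinearMap.funLeft (ZMod 2) (ZMod 2) fun y => g⁻¹ * y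

theorem translate_apply (g : C.CodeGroup) (f : C.CodeGroup → ZMod 2) (y : C.CodeGroup) :
    translate g f y = f (g⁻¹ * y) := rfl

/-- Left translation by a codeword is an affine isometry of the ambient space, so it preserves
affine functions. -/
theorem affine_mul (p : (ι → ZMod 2) × ZMod 2) (x y : C.CodeGroup) :
    affine C p (x * y) =
      affine C (p.1 ∘ C.perm x.word, ∑ i, p.1 i * x.word i + p.2) y := by
  simp only [affine_apply, word_mul, star, Pi.add_apply, Function.comp_apply, mul_add,
    Finset.sum_add_distrib]
  rw [← Equiv.sum_comp (C.perm x.word) fun i => p.1 i * y.word ((C.perm x.word).symm i)]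
  simp only [Equiv.symm_apply_apply]
  rw [add_assoc, add_left_comm]

theorem range_affine_le_comap (g : C.CodeGroup) :
    LinearMap.range (affine C) ≤ (LinearMap.range (affine C)).comap (translate g) := by
  rintro _ ⟨p, rfl⟩
  exact ⟨_, funext fun y => (affine_mul p g⁻¹ y).symm⟩

variable (C) in
/-- The functions on the group modulo the affine ones. -/
abbrev NonAffine : Type := (C.CodeGroup → ZMod 2) ⧸ LinearMap.range (affine C)

noncomputable instance : MulAction C.CodeGroup (NonAffine C) where
  smul g := (LinearMap.range (affine C)).mapQ _ (translate g) (range_affine_le_comap g)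
  one_smul f := by
    induction f using Submodule.Quotient.induction_on with
    | _ f =>
      refine congrArg (Submodule.Quotient.mk (p := LinearMap.range (affine C))) (funext fun y => ?_)
      rw [translate_apply, inv_one, one_mul]
  mul_smul g h f := by
    induction f using Submodule.Quotient.induction_on with
    | _ f =>
      refine congrArg (Submodule.Quotient.mk (p := LinearMap.range (affine C))) (funext fun y => ?_)
      rw [translate_apply, translate_apply, translate_apply, mul_inv_rev, mul_assoc]

instance : Finite (NonAffine C) :=
  Finite.of_surjective _ (Submodule.mkQ_surjective _)

theorem smul_mk (g : C.CodeGroup) (f : C.CodeGroup → ZMod 2) :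
    g • (Submodule.Quotient.mk f : NonAffine C) = Submodule.Quotient.mk (translate g f) := rfl

theorem two_dvd_natCard_nonAffine (h : Fintype.card ι + 1 < Nat.card C.CodeGroup) :
    2 ∣ Nat.card (NonAffine C) := by
  have : Fintype C.CodeGroup := Fintype.ofFinite _
  have h1 : Module.finrank (ZMod 2) (LinearMap.range (affine C)) ≤ Fintype.card ι + 1 := by
    refine (LinearMap.finrank_range_le _).trans ?_
    rw [Module.finrank_prod, Module.finrank_fintype_fun_eq_card, Module.finrank_self]
  have h2 := Submodule.finrank_quotient_add_finrank (LinearMap.range (affine C))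
  rw [Module.finrank_fintype_fun_eq_card, ← Nat.card_eq_fintype_card] at h2
  rw [Module.natCard_eq_pow_finrank (K := ZMod 2), Nat.card_zmod]
  have h3 : Module.finrank (ZMod 2)
      ((C.CodeGroup → ZMod 2) ⧸ LinearMap.range (affine C)) ≠ 0 := by omega
  exact dvd_pow_self 2 h3

/-- A function that is not affine, all of whose derivatives are affine. -/
theorem exists_nonaffine (h : Fintype.card ι + 1 < Nat.card C.CodeGroup) :
    ∃ f : C.CodeGroup → ZMod 2, f ∉ LinearMap.range (affine C) ∧
      ∀ x, ∃ p, ∀ y, f (x * y) = f y + affine C p y := by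
  have hfix : (0 : NonAffine C) ∈ MulAction.fixedPoints C.CodeGroup (NonAffine C) := fun g => by
    rw [← Submodule.Quotient.mk_zero, smul_mk, map_zero]
  -- The number of fixed points is even, and `0` is one of them, so there is another.
  obtain ⟨b, hb, hb0⟩ := isPGroup.exists_fixed_point_of_prime_dvd_card_of_fixed_point _
    (two_dvd_natCard_nonAffine h) hfix
  obtain ⟨f, rfl⟩ := Submodule.Quotient.mk_surjective _ b
  refine ⟨f, fun hf => hb0 ((Submodule.Quotient.mk_eq_zero _).2 hf).symm, fun x => ?_⟩
  have h1 := hb x⁻¹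
  rw [smul_mk, Submodule.Quotient.eq] at h1
  obtain ⟨p, hp⟩ := h1
  refine ⟨p, fun y => ?_⟩
  rw [hp, Pi.sub_apply, translate_apply, inv_inv, add_sub_cancel]

end CodeGroup

variable {C : PropelinearPerfectCode ι}

theorem eq_zero_of_span_eq_top (hC : Submodule.span (ZMod 2) C.carrier = ⊤) {a : ι → ZMod 2}
    (ha : ∀ y ∈ C.carrier, ∑ i, a i * y i = 0) : a = 0 := by
  let φ : (ι → ZMod 2) →ₗ[ZMod 2] ZMod 2 := Fintype.linearCombination (ZMod 2) a
  have hφ : ∀ y, φ y = ∑ i, a i * y i := fun y => by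
    simp only [φ, Fintype.linearCombination_apply, smul_eq_mul, mul_comm]
  have h0 : φ = 0 := LinearMap.ext_on hC fun y hy => (hφ y).trans (ha y hy)
  funext i
  have := hφ (Pi.single i 1)
  rw [h0] at this
  simpa [Pi.single_apply] using this.symm

/-- Expanding `f` on a triple product in both bracketings gives two linear forms in the last factor
that agree on `C`; as `C` spans, their coefficients agree. -/
theorem corr_star_of_span_eq_top (hC : Submodule.span (ZMod 2) C.carrier = ⊤)
    {f : (ι → ZMod 2) → ZMod 2} {b : (ι → ZMod 2) → ι → ZMod 2}
    (hf : ∀ x ∈ C.carrier, ∀ y ∈ C.carrier,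
      f (C.star x y) = f x + f y + ∑ i, b x i * y ((C.perm x).symm i))
    {x y : ι → ZMod 2} (hx : x ∈ C.carrier) (hy : y ∈ C.carrier) :
    b (C.star x y) = b x + b y ∘ (C.perm x).symm := by
  have hxy : C.star x y ∈ C.carrier := C.star_mem x hx y hy
  have hperm : C.perm (C.star x y) = C.perm x * C.perm y := C.perm_star x hx y hy
  -- Precomposing with the permutation turns the form in the permuted word into one in `w` itself.
  have h0 : (b (C.star x y) + (b x + b y ∘ (C.perm x).symm)) ∘ C.perm (C.star x y) = 0 := by
    refine eq_zero_of_span_eq_top hC fun w hw => ?_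
    have h1 := hf _ hxy w hw
    rw [C.star_assoc hx hy, hf x hx (C.star y w) (C.star_mem y hy w hw), hf y hy w hw,
      hf x hx y hy] at h1
    rw [← Equiv.sum_comp (C.perm (C.star x y)).symm]
    simp only [Function.comp_apply, Equiv.apply_symm_apply, Pi.add_apply, add_mul,
      Finset.sum_add_distrib]
    have h2 : ∑ i, b x i * C.star y w ((C.perm x).symm i) =
        ∑ i, b x i * y ((C.perm x).symm i) +
          ∑ i, b x i * w ((C.perm (C.star x y)).symm i) := by
      simp only [star, Pi.add_apply, Function.comp_apply, mul_add,
        Finset.sum_add_distrib] at hperm ⊢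
      rw [hperm]
      rfl
    have h3 : ∑ i, b y i * w ((C.perm y).symm i) =
        ∑ i, b y ((C.perm x).symm i) * w ((C.perm (C.star x y)).symm i) := by
      rw [← Equiv.sum_comp (C.perm x).symm, hperm]
      rfl
    rw [h2, h3] at h1
    have key : ∀ p q r s t u v : ZMod 2, p + (q + r + s) + (t + u) = p + q + t + r + v →
        v + (u + s) = 0 := by decide
    exact key _ _ _ _ _ _ _ h1
  have h1 : b (C.star x y) + (b x + b y ∘ (C.perm x).symm) = 0 := by
    funext i
    simpa using congrFun h0 ((C.perm (C.star x y)).symm i)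
  funext i
  exact CharTwo.add_eq_zero.1 (congrFun h1 i)

theorem exists_nonlinear_quasiHom (hC : Submodule.span (ZMod 2) C.carrier = ⊤)
    (h : Fintype.card ι + 1 < Nat.card C.carrier) :
    ∃ f : C.QuasiHom,
      ∀ ψ : (ι → ZMod 2) →ₗ[ZMod 2] ZMod 2, ∃ y ∈ C.carrier, f.toFun y ≠ ψ y := by
  classical
  obtain ⟨f, hf, hder⟩ := CodeGroup.exists_nonaffine (C := C) h
  choose p hp using hder
  -- Adding `f 1` normalises the value at the zero word, which is the identity of the group. The
  -- coefficients `b x` are the linear part of the derivative along `x`, moved by `π_x`; the values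
  -- off the code are irrelevant.
  let F : (ι → ZMod 2) → ZMod 2 := fun x =>
    if hx : x ∈ C.carrier then f (CodeGroup.ofWord hx) + f 1 else 0
  let b : (ι → ZMod 2) → ι → ZMod 2 := fun x =>
    if hx : x ∈ C.carrier then (p (CodeGroup.ofWord hx)).1 ∘ (C.perm x).symm else 0
  have hF : ∀ {x} (hx : x ∈ C.carrier), F x = f (CodeGroup.ofWord hx) + f 1 :=
    fun hx => dif_pos hx
  have hb : ∀ {x} (hx : x ∈ C.carrier),
      b x = (p (CodeGroup.ofWord hx)).1 ∘ (C.perm x).symm := fun hx => dif_pos hx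
  have hstar : ∀ x ∈ C.carrier, ∀ y ∈ C.carrier,
      F (C.star x y) = F x + F y + ∑ i, b x i * y ((C.perm x).symm i) := by
    intro x hx y hy
    have h1 := hp (CodeGroup.ofWord hx) (CodeGroup.ofWord hy)
    have h2 := hp (CodeGroup.ofWord hx) 1
    rw [mul_one, CodeGroup.affine_apply, CodeGroup.word_one] at h2
    simp only [Pi.zero_apply, mul_zero, Finset.sum_const_zero, zero_add] at h2
    have h3 : ∑ i, b x i * y ((C.perm x).symm i) =
        ∑ i, (p (CodeGroup.ofWord hx)).1 i * y i := by
      rw [hb hx]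
      exact Equiv.sum_comp (C.perm x).symm fun i => (p (CodeGroup.ofWord hx)).1 i * y i
    rw [CodeGroup.affine_apply, CodeGroup.word_ofWord] at h1
    have h4 : F (C.star x y) = f (CodeGroup.ofWord hx * CodeGroup.ofWord hy) + f 1 :=
      hF (C.star_mem x hx y hy)
    rw [h4, hF hx, hF hy, h1, h2, h3]
    generalize f 1 = u
    generalize f (CodeGroup.ofWord hy) = v
    generalize ∑ i, (p (CodeGroup.ofWord hx)).1 i * y i = s
    generalize (p (CodeGroup.ofWord hx)).2 = t
    revert u v s t
    decide
  have hF0 : F 0 = 0 := by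
    rw [hF C.zero_mem]
    exact CharTwo.add_self_eq_zero _
  refine ⟨⟨F, b, hF0, hstar, fun x hx y hy => corr_star_of_span_eq_top hC hstar hx hy⟩,
    fun ψ => ?_⟩
  by_contra! hψ
  -- If `F` were the linear form `ψ` on `C`, then `f` would be affine with constant term `f 1`.
  refine hf ⟨(fun i => ψ (Pi.single i 1), f 1), funext fun y => ?_⟩
  have h1 : F y.word = ψ y.word := hψ _ y.word_mem
  have h2 : F y.word = f y + f 1 := hF y.word_mem
  have h3 : ∑ i, ψ (Pi.single i 1) * y.word i = ψ y.word := by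
    rw [LinearMap.pi_apply_eq_sum_univ ψ y.word]
    refine Finset.sum_congr rfl fun i _ => ?_
    rw [smul_eq_mul, mul_comm]
    congr 2
    funext j
    simp [Pi.single_apply, eq_comm]
  rw [CodeGroup.affine_apply, h3, ← h1, h2, add_assoc, CharTwo.add_self_eq_zero, add_zero]

end PropelinearPerfectCode

/-! ### Renaming coordinates and the standard definitions -/

namespace PropelinearPerfectCode

section Reindex

variable {ι κ : Type} [DecidableEq ι] [DecidableEq κ]

theorem unitOrZero_comp (e : ι ≃ κ) (o : Option ι) :
    unitOrZero (o.map e) ∘ e = unitOrZero o := by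
  cases o with
  | none => rfl
  | some i =>
    funext j
    simp [unitOrZero, Pi.single_apply]

theorem comp_permCongr_symm_comp {ι κ : Type} (e : ι ≃ κ) (π : Equiv.Perm ι) (x y : κ → ZMod 2) :
    (x + y ∘ (e.permCongr π).symm) ∘ e = x ∘ e + (y ∘ e) ∘ π.symm := by
  funext i
  change x (e i) + y (e (π.symm (e.symm (e i)))) = x (e i) + y (e (π.symm i))
  rw [e.symm_apply_apply]

variable [Fintype ι] [Fintype κ]

/-- Renaming of the coordinates. -/
def reindex (C : PropelinearPerfectCode ι) (e : ι ≃ κ) : PropelinearPerfectCode κ where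
  carrier := {x | x ∘ e ∈ C.carrier}
  perm x := e.permCongr (C.perm (x ∘ e))
  zero_mem := C.zero_mem
  perfect x := by
    have key : ∀ o : Option ι, x + unitOrZero (o.map e) ∈ {x | x ∘ e ∈ C.carrier} ↔
        x ∘ e + unitOrZero o ∈ C.carrier := fun o => by
      rw [← unitOrZero_comp e o]; rfl
    obtain ⟨o, ho, huniq⟩ := C.perfect (x ∘ e)
    refine ⟨o.map e, (key o).2 ho, fun p hp => ?_⟩
    have hpe : (p.map e.symm).map e = p := by simp
    rw [← hpe] at hp ⊢
    rw [huniq _ ((key _).1 hp)]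
  star_mem x hx y hy := by
    have := C.star_mem _ hx _ hy
    rw [← comp_permCongr_symm_comp] at this
    exact this
  perm_star x hx y hy := by
    rw [comp_permCongr_symm_comp, C.perm_star _ hx _ hy]
    ext i
    simp

theorem rank_reindex (C : PropelinearPerfectCode ι) (e : ι ≃ κ) :
    (C.reindex e).rank = C.rank := by
  let L : (κ → ZMod 2) ≃ₗ[ZMod 2] (ι → ZMod 2) := LinearEquiv.funCongrLeft (ZMod 2) (ZMod 2) e
  have h : C.carrier = L '' (C.reindex e).carrier := by
    ext x
    constructor
    · intro hx
      refine ⟨L.symm x, ?_, L.apply_symm_apply x⟩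
      have : L (L.symm x) = x := L.apply_symm_apply x
      change L (L.symm x) ∈ C.carrier
      rwa [this]
    · rintro ⟨y, hy, rfl⟩
      exact hy
  have h2 : Submodule.span (ZMod 2) C.carrier =
      (Submodule.span (ZMod 2) (C.reindex e).carrier).map (L : _ →ₗ[ZMod 2] _) := by
    rw [Submodule.map_span, h]
    rfl
  rw [rank, rank, h2]
  exact (LinearEquiv.finrank_map_eq L _).symm

end Reindex

section Standard

theorem hammingDist_le_one_iff {n : ℕ} (x y : BinVec n) :
    hammingDist x y ≤ 1 ↔ ∃ o : Option (Fin n), y = x + unitOrZero o := by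
  constructor
  · intro h
    rcases Nat.le_one_iff_eq_zero_or_eq_one.1 h with h | h
    · exact ⟨none, by rw [hammingDist_eq_zero.1 h]; exact (add_zero y).symm⟩
    · obtain ⟨i, hi⟩ := Finset.card_eq_one.1 h
      refine ⟨some i, funext fun j => ?_⟩
      have hj : x j ≠ y j ↔ j = i := by
        rw [← Finset.mem_singleton, ← hi, Finset.mem_filter]
        simp
      have h2 : ∀ a b : ZMod 2, a ≠ b → b = a + 1 := by decide
      by_cases hji : j = i
      · have := h2 _ _ (hj.2 hji)
        subst hji
        simpa [unitOrZero] using this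
      · have := not_not.1 (mt hj.1 hji)
        simp [unitOrZero, hji, this]
  · rintro ⟨o, rfl⟩
    cases o with
    | none =>
      have : x + unitOrZero (none : Option (Fin n)) = x := add_zero x
      rw [this, hammingDist_self]
      exact zero_le_one
    | some i =>
      refine (Finset.card_le_card (t := {i}) fun j hj => ?_).trans (by simp)
      rw [Finset.mem_filter] at hj
      rw [Finset.mem_singleton]
      by_contra hji
      exact hj.2 (by simp [unitOrZero, hji])

variable {n : ℕ} (C : PropelinearPerfectCode (Fin n))

theorem isPerfectCode : IsPerfectCode C.carrier := by
  intro x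
  obtain ⟨o, ho, huniq⟩ := C.perfect x
  refine ⟨x + unitOrZero o, ⟨ho, (hammingDist_le_one_iff _ _).2 ⟨o, rfl⟩⟩, ?_⟩
  rintro y ⟨hy, hd⟩
  obtain ⟨p, rfl⟩ := (hammingDist_le_one_iff _ _).1 hd
  rw [huniq p hy]

theorem isPropelinear : IsPropelinear C.carrier := by
  refine ⟨⟨fun x => C.perm x, fun x => ?_, fun x y z hz => ?_⟩⟩
  · refine Set.Subset.antisymm ?_ fun z hz => ?_
    · rintro _ ⟨y, hy, rfl⟩
      exact C.star_mem x x.2 y hy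
    · obtain ⟨y, hy, h⟩ := C.exists_star_eq x.2 hz
      exact ⟨y, hy, h⟩
  · have h : C.perm (x + (y : BinVec n) ∘ (C.perm x).symm) = C.perm x * C.perm y :=
      C.perm_star x x.2 y y.2
    rw [hz]
    exact h

end Standard

/-! ### The induction on the length -/

theorem span_eq_top_of_rank {ι : Type} [Fintype ι] [DecidableEq ι]
    {C : PropelinearPerfectCode ι} (h : C.rank = Fintype.card ι) :
    Submodule.span (ZMod 2) C.carrier = ⊤ :=
  Submodule.eq_top_of_finrank_eq (h.trans (Module.finrank_fintype_fun_eq_card _).symm)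

/-- Otherwise `2 ^ n = |C| (n + 1) ≤ 2 ^ (2m)`, which contradicts `2m < 2 ^ m - 1 = n`. -/
theorem card_add_one_lt_natCard {ι : Type} [Fintype ι] [DecidableEq ι]
    (C : PropelinearPerfectCode ι) {m : ℕ} (hm : 4 ≤ m) (h : Fintype.card ι + 1 = 2 ^ m) :
    Fintype.card ι + 1 < Nat.card C.carrier := by
  have h1 := C.natCard_carrier
  have h2 : 2 * m + 1 < 2 ^ m := by
    clear h h1
    induction m, hm using Nat.le_induction with
    | base => norm_num
    | succ k _ ih => rw [pow_succ]; omega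
  by_contra! hle
  have h3 : 2 ^ Fintype.card ι ≤ 2 ^ (m + m) := by
    rw [← h1, pow_add, ← h]
    exact Nat.mul_le_mul_right _ hle
  have := (Nat.pow_le_pow_iff_right (by norm_num)).1 h3
  omega

theorem exists_of_table {T : SyndromeTable} {e d : ℕ} (h : T.check e = true)
    (hd : e + d = T.lifts.length) :
    ∃ (ι : Type) (_ : Fintype ι) (_ : DecidableEq ι) (C : PropelinearPerfectCode ι),
      Fintype.card ι + 1 = 2 ^ 4 ∧ C.rank + d = Fintype.card ι :=
  ⟨Fin 15, inferInstance, inferInstance, (SyndromeTable.valid_of_check T h).code, by simp, by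
    rw [(SyndromeTable.valid_of_check T h).rank_code hd, Fintype.card_fin]⟩

theorem exists_rank_add_eq {m : ℕ} (hm : 4 ≤ m) {d : ℕ} (hd : d ≤ m) :
    ∃ (ι : Type) (_ : Fintype ι) (_ : DecidableEq ι) (C : PropelinearPerfectCode ι),
      Fintype.card ι + 1 = 2 ^ m ∧ C.rank + d = Fintype.card ι := by
  induction m, hm using Nat.le_induction generalizing d with
  | base =>
    interval_cases d
    · exact exists_of_table table15_check rfl
    · exact exists_of_table table14_check rfl
    · exact exists_of_table table13_check rfl
    · exact exists_of_table table12_check rfl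
    · exact exists_of_table table11_check rfl
  | succ m hm ih =>
    have hcard : ∀ {a : ℕ}, a + 1 = 2 ^ m → a * 2 + 1 + 1 = 2 ^ (m + 1) := fun h => by
      rw [pow_succ, ← h]; ring
    cases d with
    | zero =>
      obtain ⟨ι, _, _, C, hι, hC⟩ := ih (Nat.zero_le m)
      have htop := span_eq_top_of_rank hC
      obtain ⟨f, hf⟩ := exists_nonlinear_quasiHom htop (C.card_add_one_lt_natCard hm hι)
      refine ⟨_, inferInstance, inferInstance, vasilev f, ?_, ?_⟩
      · rw [Fintype.card_option, Fintype.card_prod, ZMod.card, hcard hι]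
      · rw [rank, span_vasilev_eq_top htop hf, finrank_top, add_zero,
          Module.finrank_fintype_fun_eq_card]
    | succ d =>
      obtain ⟨ι, _, _, C, hι, hC⟩ := ih (Nat.le_of_succ_le_succ hd)
      refine ⟨_, inferInstance, inferInstance, vasilev C.zeroQuasiHom, ?_, ?_⟩
      · rw [Fintype.card_option, Fintype.card_prod, ZMod.card, hcard hι]
      · rw [rank_vasilev_zero, Fintype.card_option, Fintype.card_prod, ZMod.card]
        omega

end PropelinearPerfectCode

theorem mainTheorem1 (m n r : ℕ) (hm : 4 ≤ m) (hn : n = 2 ^ m - 1)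
    (hr_lower : (n : ℝ) - Real.logb 2 ((n : ℝ) + 1) ≤ (r : ℝ)) (hr_upper : r ≤ n)
    (h63 : ¬ (n = 63 ∧ r = 63))
    (h127 : ¬ (n = 127 ∧ (r = 126 ∨ r = 127)))
    (h2047 : ¬ (n = 2047 ∧ r = 2047)) :
    ∃ C : Set (BinVec n),
      0 ∈ C ∧ IsPerfectCode C ∧ IsPropelinear C ∧ codeRank C = r := by
  have hn1 : n + 1 = 2 ^ m := by
    have := Nat.one_le_two_pow (n := m)
    omega
  have hlog : Real.logb 2 ((n : ℝ) + 1) = m := by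
    have : (n : ℝ) + 1 = 2 ^ m := by exact_mod_cast hn1
    rw [this, Real.logb_pow, Real.logb_self_eq_one (by norm_num), mul_one]
  -- Since `log₂ (n + 1) = m`, the lower bound on `r` says exactly that the deficiency is at most
  -- `m`.
  have hd : n - r ≤ m := by
    rw [hlog] at hr_lower
    have : (n : ℝ) ≤ ((m + r : ℕ) : ℝ) := by push_cast; linarith
    have : n ≤ m + r := by exact_mod_cast this
    omega
  obtain ⟨ι, _, _, C, hι, hC⟩ := PropelinearPerfectCode.exists_rank_add_eq hm hd
  let e : ι ≃ Fin n := Fintype.equivFinOfCardEq (by omega)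
  have hcard : Fintype.card ι = n := by omega
  refine ⟨(C.reindex e).carrier, (C.reindex e).zero_mem, (C.reindex e).isPerfectCode,
    (C.reindex e).isPropelinear, ?_⟩
  have := C.rank_reindex e
  rw [PropelinearPerfectCode.rank] at this
  rw [codeRank, this]
  omega
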